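/- Let $\mathbb{D}$ be the open unit disk. A \emph{self-map} of $\mathbb{D}$ is an analytic function $f:\mathbb{D}\to\mathbb{D}$, and $f_n$ denotes its $n$-th iterate. It is called \emph{elliptic} if it is not the identity and has a fixed point in $\mathbb{D}$. A \emph{linear fractional} self-map is one of the form $z\mapsto (az+b)/(cz+d)$ with $ad-bc\neq 0$. For $p\in\mathbb{D}$ let $\varphi_p(z)=\dfrac{p-z}{1-\overline{p}z}$, an involutive automorphism of $\mathbb{D}$ interchanging $p$ and $0$. \textbf{Theorem.} Let $\varphi$ be an elliptic linear fractional self-map of $\mathbb{D}$ (in particular $\varphi$ is not the identity), and let $p\in\mathbb{D}$ be its Denjoy--Wolff point, that is, its fixed point in $\mathbb{D}$; it is the only fixed point of $\varphi$ in $\mathbb{D}$. Then there are $A,C\in\mathbb{C}$ with $|A|+|C|\le 1$ and $A\neq 1$ such that $$(\varphi_p\circ\varphi\circ\varphi_p)(z)=\frac{Az}{Cz+1},\qquad z\in\mathbb{D},$$ and such that the following holds for every integer $n\ge 1$. (i) The number of self-maps $f$ of $\mathbb{D}$ with $f_n=\varphi$ equals the cardinality of the set $$R_n=\{a\in\mathbb{C}\,:\,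 a^n=A \text{ and } |C(1-a)|\le (1-|a|)\,|1-A|\}.$$ (ii) More precisely, the map $a\mapsto f=\varphi_p\circ g\circ\varphi_p$, where $$g(z)=\frac{az}{\frac{C(1-a)}{1-A}\,z+1},$$ is a bijection from $R_n$ onto the set of self-maps $f$ of $\mathbb{D}$ with $f_n=\varphi$ (for $a\in R_n$ the function $g$ is a self-map of $\mathbb{D}$). Every such solution $f$ is an elliptic linear fractional self-map of $\mathbb{D}$. (iii) If $\varphi$ is an automorphism of $\mathbb{D}$, then there are exactly $n$ self-maps $f$ of $\mathbb{D}$ with $f_n=\varphi$. -/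

import Mathlib

open scoped Complex.UnitDisc ComplexConjugate

/-- A self-map of the open unit disk is analytic if it is the restriction of a function that is
complex differentiable on the open unit disk of `ℂ`. -/
def IsAnalyticSelfMap (f : 𝔻 → 𝔻) : Prop :=
  ∃ F : ℂ → ℂ, DifferentiableOn ℂ F (Metric.ball 0 1) ∧ ∀ z : 𝔻, (f z : ℂ) = F z

/-- A linear fractional self-map of the disk: `f z = (a z + b) / (c z + d)` with `ad - bc ≠ 0`
and no pole in the disk. -/
def IsLinearFractional (f : 𝔻 → 𝔻) : Prop :=
  ∃ a b c d : ℂ, a * d - b * c ≠ 0 ∧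
    ∀ z : 𝔻, c * z + d ≠ 0 ∧ (f z : ℂ) = (a * z + b) / (c * z + d)

/-- An elliptic self-map of the disk: an analytic self-map, other than the identity, with a fixed
point inside the disk. -/
def IsElliptic (f : 𝔻 → 𝔻) : Prop :=
  IsAnalyticSelfMap f ∧ f ≠ id ∧ ∃ p : 𝔻, f p = p

/-- A disk automorphism: a bijective analytic self-map of the disk. -/
def IsDiskAutomorphism (f : 𝔻 → 𝔻) : Prop :=
  IsAnalyticSelfMap f ∧ Function.Bijective f

theorem norm_diskInvolution_lt_one (p z : 𝔻) :
    ‖((p : ℂ) - z) / (1 - conj (p : ℂ) * z)‖ < 1 := by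
  have hp : Complex.normSq (p : ℂ) < 1 := p.normSq_lt_one
  have hz : Complex.normSq (z : ℂ) < 1 := z.normSq_lt_one
  have key : Complex.normSq ((p : ℂ) - z) < Complex.normSq (1 - conj (p : ℂ) * z) := by
    simp only [Complex.normSq_apply, Complex.sub_re, Complex.sub_im, Complex.mul_re,
      Complex.mul_im, Complex.one_re, Complex.one_im, Complex.conj_re, Complex.conj_im] at *
    nlinarith [mul_pos (sub_pos.2 hp) (sub_pos.2 hz)]
  have h0 : 0 < Complex.normSq (1 - conj (p : ℂ) * z) :=
    lt_of_le_of_lt (Complex.normSq_nonneg _) key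
  rw [Complex.normSq_eq_norm_sq] at key h0
  rw [Complex.normSq_eq_norm_sq] at key
  have h1 : 0 < ‖1 - conj (p : ℂ) * (z : ℂ)‖ := by
    by_contra h
    have : ‖1 - conj (p : ℂ) * (z : ℂ)‖ = 0 := le_antisymm (not_lt.1 h) (norm_nonneg _)
    simp [this] at h0
  rw [norm_div, div_lt_one h1]
  exact lt_of_pow_lt_pow_left₀ 2 h1.le key

/-- The involutive disk automorphism `z ↦ (p - z) / (1 - conj p * z)` interchanging `p`
and `0`. -/
noncomputable def diskInvolution (p : 𝔻) : 𝔻 → 𝔻 := fun z =>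
  Complex.UnitDisc.mk (((p : ℂ) - z) / (1 - conj (p : ℂ) * z)) (norm_diskInvolution_lt_one p z)

/-- The self-map `g` of the disk is given by `g z = A z / (C z + 1)`, with no pole in the disk. -/
def HasNormalForm (g : 𝔻 → 𝔻) (A C : ℂ) : Prop :=
  ∀ z : 𝔻, C * z + 1 ≠ 0 ∧ (g z : ℂ) = A * z / (C * z + 1)

/-- The analytic self-maps `f` of the disk whose `n`-th iterate is `φ`. -/
def iterativeRoots (φ : 𝔻 → 𝔻) (n : ℕ) : Set (𝔻 → 𝔻) :=
  {f | IsAnalyticSelfMap f ∧ f^[n] = φ}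

/-- The `n`-th roots `a` of `A` with `|C (1 - a)| ≤ (1 - |a|) |1 - A|`. -/
def admissibleRoots (A C : ℂ) (n : ℕ) : Set ℂ :=
  {a | a ^ n = A ∧ ‖C * (1 - a)‖ ≤ (1 - ‖a‖) * ‖1 - A‖}

/-!
After conjugation with `diskInvolution p` the fixed point is `0`, and a linear fractional self-map
`ψ` fixing `0` has the form `A z / (C z + 1)`. Testing the self-map property on the radius on which
`C z < 0` shows that such a formula defines a self-map exactly when `|A| + |C| ≤ 1`
(`HasNormalForm.norm_add_norm_le_one`, `exists_hasNormalForm`).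

Put `E = C / (1 - A)`. The coordinate `koenigs E z = z / (1 + E z)` has no pole in the disk, is
injective there, and turns `ψ` into multiplication by `A`. In the same way a self-map `g` becomes
multiplication by `a` in this coordinate exactly when `g z = a z / (E (1 - a) z + 1)`
(`hasNormalForm_iff_koenigs`). Thus each `n`-th root `a` of `A` yields an `n`-th iterative root of
`ψ` as soon as this formula defines a self-map, that is, when `|a| + |E (1 - a)| ≤ 1`.

Conversely, an iterative root `g` of `ψ` commutes with `ψ`, hence fixes `0`, and its multiplier
`a = g'(0)` satisfies `a ^ n = A`. If `|A| < 1`, the function `koenigs E (g z) / koenigs E z` is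
invariant under `ψ`, whose orbits converge to `0`, so it is constantly `a`
(`koenigs_apply_of_commute`). If `|A| = 1`, then `C = 0` and `|a| = 1`, and equality in the Schwarz
lemma makes `g` the rotation by `a`. Both cases are collected in
`HasNormalForm.mem_iterativeRoots_iff`.

If `φ` is an automorphism, the bound on coefficients applied to the inverse of `ψ` gives `|A| = 1`
and `C = 0`, and then all `n` roots of `A` are admissible.
-/

/-! ### Möbius maps and analytic self-maps -/

theorem IsAnalyticSelfMap.comp {f g : 𝔻 → 𝔻} (hf : IsAnalyticSelfMap f)
    (hg : IsAnalyticSelfMap g) : IsAnalyticSelfMap (f ∘ g) := by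
  obtain ⟨F, hF, hfF⟩ := hf
  obtain ⟨G, hG, hgG⟩ := hg
  refine ⟨F ∘ G, hF.comp hG fun z hz => ?_, fun z => by simp [hfF, hgG]⟩
  have h := hgG (.mk z (by simpa using hz))
  rw [Complex.UnitDisc.coe_mk] at h
  rw [← h]
  simpa using Complex.UnitDisc.norm_lt_one _

theorem IsLinearFractional.comp {f g : 𝔻 → 𝔻} (hf : IsLinearFractional f)
    (hg : IsLinearFractional g) : IsLinearFractional (f ∘ g) := by
  obtain ⟨a, b, c, d, h, hf⟩ := hf
  obtain ⟨a', b', c', d', h', hg⟩ := hg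
  refine ⟨a * a' + b * c', a * b' + b * d', c * a' + d * c', c * b' + d * d', ?_, fun z => ?_⟩
  · convert mul_ne_zero h h' using 1
    ring
  · obtain ⟨h1, h2⟩ := hg z
    obtain ⟨h3, h4⟩ := hf (g z)
    have h5 : (c * a' + d * c') * (z : ℂ) + (c * b' + d * d') = (c * g z + d) * (c' * z + d') := by
      rw [h2]
      field_simp
      ring
    refine ⟨h5 ▸ mul_ne_zero h3 h1, ?_⟩
    rw [Function.comp_apply, h4, h5, div_eq_div_iff h3 (mul_ne_zero h3 h1)]
    rw [eq_div_iff h1] at h2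
    linear_combination (c * g z + d) * a * h2

theorem IsLinearFractional.isAnalyticSelfMap {f : 𝔻 → 𝔻} (hf : IsLinearFractional f) :
    IsAnalyticSelfMap f := by
  obtain ⟨a, b, c, d, -, hf⟩ := hf
  refine ⟨fun z => (a * z + b) / (c * z + d), ?_, fun z => (hf z).2⟩
  refine DifferentiableOn.div (by fun_prop) (by fun_prop) fun z hz => ?_
  exact (hf (.mk z (by simpa using hz))).1

theorem one_sub_conj_mul_ne_zero (p z : 𝔻) : 1 - conj (p : ℂ) * z ≠ 0 := by
  intro h
  have h1 : ‖conj (p : ℂ) * z‖ = 1 := by rw [← sub_eq_zero.1 h, norm_one]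
  rw [norm_mul, RCLike.norm_conj] at h1
  nlinarith [p.norm_lt_one, z.norm_lt_one, norm_nonneg (p : ℂ), norm_nonneg (z : ℂ)]

theorem coe_diskInvolution (p z : 𝔻) :
    (diskInvolution p z : ℂ) = ((p : ℂ) - z) / (1 - conj (p : ℂ) * z) := rfl

theorem diskInvolution_involutive (p : 𝔻) : Function.Involutive (diskInvolution p) := by
  intro z
  apply Complex.UnitDisc.coe_injective
  have h := one_sub_conj_mul_ne_zero p z
  have h1 := one_sub_conj_mul_ne_zero p (diskInvolution p z)
  have h2 := coe_diskInvolution p z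
  rw [eq_div_iff h] at h2
  rw [coe_diskInvolution, div_eq_iff h1]
  linear_combination -h2

theorem diskInvolution_zero (p : 𝔻) : diskInvolution p 0 = p := by
  apply Complex.UnitDisc.coe_injective
  simp [coe_diskInvolution]

theorem diskInvolution_self (p : 𝔻) : diskInvolution p p = 0 := by
  apply Complex.UnitDisc.coe_injective
  simp [coe_diskInvolution]

theorem isLinearFractional_diskInvolution (p : 𝔻) : IsLinearFractional (diskInvolution p) := by
  refine ⟨-1, p, -conj (p : ℂ), 1, ?_, fun z => ?_⟩
  · have := one_sub_conj_mul_ne_zero p p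
    contrapose! this
    linear_combination -this
  · have e : -conj (p : ℂ) * z + 1 = 1 - conj (p : ℂ) * z := by ring
    rw [e, coe_diskInvolution]
    exact ⟨one_sub_conj_mul_ne_zero p z, by ring⟩

/-! ### Conjugation by an involution -/

theorem conj_conj_of_involutive {α : Type*} {ι : α → α} (hι : Function.Involutive ι)
    (f : α → α) : ι ∘ (ι ∘ f ∘ ι) ∘ ι = f := by
  funext z
  simp [hι _]

theorem iterate_conj_of_involutive {α : Type*} {ι : α → α} (hι : Function.Involutive ι)
    (f : α → α) (n : ℕ) : (ι ∘ f ∘ ι)^[n] = ι ∘ f^[n] ∘ ι := by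
  have h : Function.Semiconj ι f (ι ∘ f ∘ ι) := fun z => by simp [hι z]
  funext z
  simpa [hι z] using (h.iterate_right n (ι z)).symm

theorem conj_mem_iterativeRoots_iff (p : 𝔻) {φ f : 𝔻 → 𝔻} {n : ℕ} :
    diskInvolution p ∘ f ∘ diskInvolution p ∈
      iterativeRoots (diskInvolution p ∘ φ ∘ diskInvolution p) n ↔ f ∈ iterativeRoots φ n := by
  have hι := diskInvolution_involutive p
  have key : ∀ {φ f : 𝔻 → 𝔻}, f ∈ iterativeRoots φ n → diskInvolution p ∘ f ∘ diskInvolution p ∈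
      iterativeRoots (diskInvolution p ∘ φ ∘ diskInvolution p) n := by
    rintro φ f ⟨hf, rfl⟩
    have ha := (isLinearFractional_diskInvolution p).isAnalyticSelfMap
    exact ⟨ha.comp (hf.comp ha), iterate_conj_of_involutive hι f n⟩
  refine ⟨fun h => ?_, key⟩
  simpa only [conj_conj_of_involutive hι] using key h

/-! ### Normal forms at a fixed point at the origin -/

theorem HasNormalForm.eq {g h : 𝔻 → 𝔻} {A C : ℂ} (hg : HasNormalForm g A C)
    (hh : HasNormalForm h A C) : g = h :=
  funext fun z => Complex.UnitDisc.coe_injective ((hg z).2.trans (hh z).2.symm)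

theorem HasNormalForm.isLinearFractional {g : 𝔻 → 𝔻} {A C : ℂ} (hg : HasNormalForm g A C)
    (hA : A ≠ 0) : IsLinearFractional g :=
  ⟨A, 0, C, 1, by simpa using hA, fun z => by simpa using hg z⟩

theorem IsLinearFractional.exists_hasNormalForm {g : 𝔻 → 𝔻} (hg : IsLinearFractional g)
    (h0 : g 0 = 0) : ∃ A C : ℂ, A ≠ 0 ∧ HasNormalForm g A C := by
  obtain ⟨a, b, c, d, hdet, hg⟩ := hg
  have hd : d ≠ 0 := by simpa using (hg 0).1
  have hb : b = 0 := by simpa [h0, hd] using (hg 0).2.symm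
  subst hb
  have ha : a ≠ 0 := by
    rintro rfl
    simp at hdet
  refine ⟨a / d, c / d, div_ne_zero ha hd, fun z => ?_⟩
  obtain ⟨h1, h2⟩ := hg z
  have e : c / d * z + 1 = (c * z + d) / d := by field_simp
  refine ⟨e ▸ div_ne_zero h1 hd, ?_⟩
  rw [h2, e]
  field_simp
  ring

/-- The size condition on the coefficients is seen on the radius on which `C z` is negative: there
`|C z + 1|` is smallest. -/
theorem HasNormalForm.norm_add_norm_le_one {g : 𝔻 → 𝔻} {A C : ℂ} (hg : HasNormalForm g A C) :
    ‖A‖ + ‖C‖ ≤ 1 := by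
  obtain ⟨u, hu, huC⟩ := RCLike.exists_norm_eq_mul_self C
  have key : ∀ t : ℝ, 0 ≤ t → t < 1 → 1 - t * ‖C‖ ≠ 0 ∧ t * ‖A‖ < |1 - t * ‖C‖| := by
    intro t ht0 ht1
    have hz : ‖-(t : ℂ) * u‖ < 1 := by
      rw [norm_mul, norm_neg, hu, Complex.norm_real, Real.norm_of_nonneg ht0, mul_one]
      exact ht1
    obtain ⟨h1, h2⟩ := hg (.mk _ hz)
    have h3 := (g (.mk _ hz)).norm_lt_one
    rw [Complex.UnitDisc.coe_mk] at h1 h2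
    have e : C * (-(t : ℂ) * u) + 1 = ((1 - t * ‖C‖ : ℝ) : ℂ) := by
      push_cast
      rw [show ((‖C‖ : ℝ) : ℂ) = u * C from huC]
      ring
    rw [e] at h1 h2
    rw [h2, norm_div, div_lt_one (norm_pos_iff.2 h1), Complex.norm_real, norm_mul, norm_mul,
      norm_neg, hu, Complex.norm_real, Real.norm_of_nonneg ht0, mul_one, Real.norm_eq_abs] at h3
    exact ⟨by exact_mod_cast h1, by linarith⟩
  have hC : ‖C‖ ≤ 1 := by
    by_contra! h
    refine (key ‖C‖⁻¹ (by positivity) (inv_lt_one_of_one_lt₀ h)).1 ?_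
    rw [inv_mul_cancel₀ (by positivity), sub_self]
  by_contra! h
  have hS : 0 < ‖A‖ + ‖C‖ := by linarith
  have h1 := (key (‖A‖ + ‖C‖)⁻¹ (by positivity) (inv_lt_one_of_one_lt₀ h)).2
  have h2 : (‖A‖ + ‖C‖)⁻¹ * (‖A‖ + ‖C‖) = 1 := inv_mul_cancel₀ hS.ne'
  have h3 : 0 ≤ (‖A‖ + ‖C‖)⁻¹ * ‖A‖ := by positivity
  rw [abs_of_nonneg (by nlinarith)] at h1
  nlinarith

theorem exists_hasNormalForm {a D : ℂ} (h : ‖a‖ + ‖D‖ ≤ 1) :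
    ∃ g : 𝔻 → 𝔻, HasNormalForm g a D := by
  have key : ∀ z : 𝔻, ‖a * z‖ < ‖D * z + 1‖ := by
    intro z
    have h1 : 1 ≤ ‖D * (z : ℂ) + 1‖ + ‖D * (z : ℂ)‖ := by
      simpa using norm_sub_le (D * (z : ℂ) + 1) (D * z)
    rw [norm_mul] at h1 ⊢
    have hz := z.norm_lt_one
    nlinarith [norm_nonneg (z : ℂ), norm_nonneg a]
  refine ⟨fun z => .mk (a * z / (D * z + 1)) ?_, fun z => ⟨?_, rfl⟩⟩
  · rw [norm_div, div_lt_one ((norm_nonneg _).trans_lt (key z))]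
    exact key z
  · exact norm_pos_iff.1 ((norm_nonneg _).trans_lt (key z))

/-- The inverse of such a map is given by `w ↦ A⁻¹ w / (-(C / A) w + 1)`, to which the size
condition on coefficients applies as well. -/
theorem HasNormalForm.norm_eq_one_of_surjective {g : 𝔻 → 𝔻} {A C : ℂ} (hg : HasNormalForm g A C)
    (hA : A ≠ 0) (hsurj : Function.Surjective g) : ‖A‖ = 1 ∧ C = 0 := by
  obtain ⟨k, hk⟩ := hsurj.hasRightInverse
  have hinv : HasNormalForm k A⁻¹ (-(C / A)) := by
    intro w
    obtain ⟨h1, h2⟩ := hg (k w)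
    rw [hk w] at h2
    have h3 : -(C / A) * (w : ℂ) + 1 = (C * k w + 1)⁻¹ := by
      rw [h2]
      field_simp
      ring
    refine ⟨h3 ▸ inv_ne_zero h1, ?_⟩
    rw [h3, h2, div_inv_eq_mul, mul_assoc, div_mul_cancel₀ _ h1, inv_mul_cancel_left₀ hA]
  have h1 := hg.norm_add_norm_le_one
  have h2 := hinv.norm_add_norm_le_one
  have hpos := norm_pos_iff.2 hA
  rw [norm_neg, norm_div, norm_inv, inv_eq_one_div, ← add_div, div_le_one hpos] at h2
  have hC : ‖C‖ = 0 := le_antisymm (by linarith) (norm_nonneg _)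
  exact ⟨by linarith, norm_eq_zero.1 hC⟩

/-! ### Linearization -/

/-- The coordinate `z / (1 + E z)` on the disk. For `E = C / (1 - A)` it linearizes
`z ↦ A z / (C z + 1)` at its fixed point `0` (Koenigs function). -/
noncomputable def koenigs (E z : ℂ) : ℂ := z / (1 + E * z)

theorem koenigs_injective {E z w : ℂ} (hz : 1 + E * z ≠ 0) (hw : 1 + E * w ≠ 0)
    (h : koenigs E z = koenigs E w) : z = w := by
  rw [koenigs, koenigs, div_eq_div_iff hz hw] at h
  linear_combination h

theorem koenigs_ne_zero {E z : ℂ} (hz : 1 + E * z ≠ 0) (h : z ≠ 0) : koenigs E z ≠ 0 :=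
  div_ne_zero h hz

theorem eq_div_of_koenigs {E z : ℂ} (hz : 1 + E * z ≠ 0) :
    z = koenigs E z / (1 - E * koenigs E z) := by
  have h : 1 - E * koenigs E z = 1 / (1 + E * z) := by
    rw [koenigs]
    field_simp
    ring
  rw [h, koenigs, div_div_div_cancel_right₀ hz, div_one]

theorem hasNormalForm_iff_koenigs {E a : ℂ} (hE : ∀ z : 𝔻, 1 + E * (z : ℂ) ≠ 0) {g : 𝔻 → 𝔻} :
    HasNormalForm g a (E * (1 - a)) ↔ ∀ z : 𝔻, koenigs E (g z) = a * koenigs E z := by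
  refine forall_congr' fun z => ?_
  have hz := hE z
  have hg := hE (g z)
  rw [koenigs, koenigs, mul_div_assoc', div_eq_div_iff hg hz]
  constructor
  · rintro ⟨h1, h2⟩
    rw [eq_div_iff h1] at h2
    linear_combination h2
  · intro h
    have h1 : E * (1 - a) * (z : ℂ) + 1 ≠ 0 := by
      intro h0
      have h2 : a * (z : ℂ) = 0 := by linear_combination (g z : ℂ) * h0 - h
      apply hz
      linear_combination h0 + E * h2
    refine ⟨h1, ?_⟩
    rw [eq_div_iff h1]
    linear_combination h

theorem koenigs_iterate {E a : ℂ} {g : 𝔻 → 𝔻}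
    (h : ∀ z : 𝔻, koenigs E (g z) = a * koenigs E z) (n : ℕ) (z : 𝔻) :
    koenigs E (g^[n] z) = a ^ n * koenigs E z := by
  induction n with
  | zero => simp
  | succ n ih => rw [Function.iterate_succ_apply', h, ih, pow_succ']; ring

theorem one_add_mul_ne_zero {A C : ℂ} (hA : A ≠ 1) (h : ‖A‖ + ‖C‖ ≤ 1) (z : 𝔻) :
    1 + C / (1 - A) * (z : ℂ) ≠ 0 := by
  have hA' : 1 - A ≠ 0 := sub_ne_zero.2 hA.symm
  have h1 : 1 ≤ ‖1 - A‖ + ‖A‖ := by simpa using norm_add_le (1 - A) A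
  intro h0
  have h2 : C * z = -(1 - A) := by
    field_simp at h0
    linear_combination h0
  have h3 : ‖C‖ * ‖(z : ℂ)‖ = ‖1 - A‖ := by rw [← norm_mul, h2, norm_neg]
  nlinarith [z.norm_lt_one, norm_nonneg C, norm_nonneg (z : ℂ), norm_pos_iff.2 hA']

theorem HasNormalForm.koenigs_apply {ψ : 𝔻 → 𝔻} {A C : ℂ} (hψ : HasNormalForm ψ A C)
    (hA : A ≠ 1) (z : 𝔻) :
    koenigs (C / (1 - A)) (ψ z) = A * koenigs (C / (1 - A)) z := by
  revert z
  rw [← hasNormalForm_iff_koenigs (one_add_mul_ne_zero hA hψ.norm_add_norm_le_one),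
    div_mul_cancel₀ _ (sub_ne_zero.2 hA.symm)]
  exact hψ

theorem HasNormalForm.eq_zero_of_isFixedPt {ψ : 𝔻 → 𝔻} {A C : ℂ} (hψ : HasNormalForm ψ A C)
    (hA : A ≠ 1) {z : 𝔻} (hz : ψ z = z) : z = 0 := by
  by_contra h
  have h1 := hψ.koenigs_apply hA z
  rw [hz] at h1
  have h2 := koenigs_ne_zero (one_add_mul_ne_zero hA hψ.norm_add_norm_le_one z)
    (mt Complex.UnitDisc.coe_eq_zero.1 h)
  exact hA (mul_right_cancel₀ h2 (by rw [← h1, one_mul]))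

/-! ### Iterative roots -/

theorem coe_iterate {g : 𝔻 → 𝔻} {G : ℂ → ℂ} (h : ∀ z : 𝔻, (g z : ℂ) = G z) (n : ℕ) (z : 𝔻) :
    ((g^[n] z : 𝔻) : ℂ) = G^[n] z := by
  induction n with
  | zero => rfl
  | succ n ih => rw [Function.iterate_succ_apply', Function.iterate_succ_apply', h, ih]

/-- The multiplier at the fixed point `0` of an `n`-th iterative root of `z ↦ A z / (C z + 1)` is
an `n`-th root of `A`. -/
theorem pow_eq_of_iterate_eq {g ψ : 𝔻 → 𝔻} {G : ℂ → ℂ} {A C a : ℂ} {n : ℕ}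
    (hψ : HasNormalForm ψ A C) (hG : ∀ z : 𝔻, (g z : ℂ) = G z) (hg0 : g 0 = 0)
    (hd : HasDerivAt G a 0) (hn : g^[n] = ψ) : a ^ n = A := by
  have hG0 : G 0 = 0 := by simpa [hg0] using (hG 0).symm
  have h1 : HasDerivAt (fun z : ℂ => A * z / (C * z + 1)) A 0 := by
    have := ((hasDerivAt_id' (0 : ℂ)).const_mul A).fun_div
      (((hasDerivAt_id' (0 : ℂ)).const_mul C).add_const 1) (by simp)
    simpa using this
  refine (HasDerivAt.iterate 0 hd hG0 n).unique (h1.congr_of_eventuallyEq ?_)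
  filter_upwards [Metric.ball_mem_nhds (0 : ℂ) one_pos] with z hz
  have h2 := coe_iterate hG n (.mk z (by simpa using hz))
  rw [hn, (hψ _).2] at h2
  exact h2.symm

/-- The orbits of `z ↦ A z / (C z + 1)` with `|A| < 1` tend to `0`, because they do so in the
linearizing coordinate. -/
theorem HasNormalForm.tendsto_iterate {ψ : 𝔻 → 𝔻} {A C : ℂ} (hψ : HasNormalForm ψ A C)
    (hA : ‖A‖ < 1) (z : 𝔻) :
    Filter.Tendsto (fun k => ((ψ^[k] z : 𝔻) : ℂ)) Filter.atTop (nhds 0) := by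
  have hA1 : A ≠ 1 := by
    rintro rfl
    simp at hA
  have hE := one_add_mul_ne_zero hA1 hψ.norm_add_norm_le_one
  have hlin := hψ.koenigs_apply hA1
  generalize C / (1 - A) = E at hE hlin
  have h1 : Filter.Tendsto (fun k => koenigs E (ψ^[k] z)) Filter.atTop (nhds 0) := by
    simp_rw [koenigs_iterate hlin]
    simpa using (tendsto_pow_atTop_nhds_zero_of_norm_lt_one hA).mul_const (koenigs E z)
  have h2 : Filter.Tendsto (fun w : ℂ => w / (1 - E * w)) (nhds 0) (nhds 0) := by
    have : ContinuousAt (fun w : ℂ => w / (1 - E * w)) 0 :=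
      ContinuousAt.div (by fun_prop) (by fun_prop) (by simp)
    simpa [ContinuousAt] using this
  exact (h2.comp h1).congr fun k => (eq_div_of_koenigs (hE _)).symm

/-- When `|A| < 1`, the quotient of `koenigs E ∘ g` by `koenigs E` is constant along orbits of `ψ`,
which tend to `0`, so it equals its limit `g'(0)` at `0`. -/
theorem koenigs_apply_of_commute {g ψ : 𝔻 → 𝔻} {G : ℂ → ℂ} {A C a : ℂ}
    (hψ : HasNormalForm ψ A C) (hA0 : A ≠ 0) (hA : ‖A‖ < 1) (hG : ∀ z : 𝔻, (g z : ℂ) = G z)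
    (hg0 : g 0 = 0) (hd : HasDerivAt G a 0) (hcomm : Function.Commute g ψ) (z : 𝔻) :
    koenigs (C / (1 - A)) (g z) = a * koenigs (C / (1 - A)) z := by
  have hA1 : A ≠ 1 := by
    rintro rfl
    simp at hA
  have hG0 : G 0 = 0 := by simpa [hg0] using (hG 0).symm
  have hE := one_add_mul_ne_zero hA1 hψ.norm_add_norm_le_one
  have hlin := hψ.koenigs_apply hA1
  generalize C / (1 - A) = E at hE hlin
  by_cases hz : z = 0
  · simp [hz, hg0, koenigs]
  have hz' : koenigs E z ≠ 0 := koenigs_ne_zero (hE z) (mt Complex.UnitDisc.coe_eq_zero.1 hz)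
  have horb : ∀ k, koenigs E (ψ^[k] z) ≠ 0 := fun k => by
    rw [koenigs_iterate hlin]
    exact mul_ne_zero (pow_ne_zero k hA0) hz'
  have horb' : ∀ k, ((ψ^[k] z : 𝔻) : ℂ) ≠ 0 := fun k h => horb k (by simp [h, koenigs])
  have ht := hψ.tendsto_iterate hA z
  have hH : HasDerivAt (fun w => koenigs E (G w)) a 0 := by
    have := hd.fun_div ((hd.const_mul E).const_add 1) (by simp [hG0])
    simpa [koenigs, hG0] using this
  have hslope := hH.tendsto_slope.comp
    (tendsto_nhdsWithin_iff.2 ⟨ht, Filter.Eventually.of_forall horb'⟩)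
  have hlim := hslope.mul ((ht.const_mul E).const_add 1)
  rw [mul_zero, add_zero, mul_one] at hlim
  have hconst : ∀ k, slope (fun w => koenigs E (G w)) 0 (ψ^[k] z) * (1 + E * (ψ^[k] z : 𝔻)) =
      koenigs E (g z) / koenigs E z := by
    intro k
    have h1 : koenigs E (G (ψ^[k] z : 𝔻)) = A ^ k * koenigs E (g z) := by
      rw [← hG, ← koenigs_iterate hlin, (hcomm.iterate_right k).eq]
    have h2 := koenigs_iterate hlin k z
    rw [slope_def_field, h1]
    have h3 : koenigs E (G 0) = 0 := by simp [hG0, koenigs]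
    rw [h3, sub_zero, sub_zero, div_mul_eq_mul_div, ← div_div_eq_mul_div]
    change _ / koenigs E (ψ^[k] z : 𝔻) = _
    rw [h2, mul_div_mul_left _ _ (pow_ne_zero k hA0)]
  have h := tendsto_nhds_unique (hlim.congr hconst) tendsto_const_nhds
  rw [h, div_mul_cancel₀ _ hz']

/-- The iterative roots of `z ↦ A z / (C z + 1)` are the maps that become multiplication by an
`n`-th root of `A` in the linearizing coordinate and that map the disk into itself. -/
theorem HasNormalForm.mem_iterativeRoots_iff {ψ g : 𝔻 → 𝔻} {A C : ℂ} {n : ℕ}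
    (hψ : HasNormalForm ψ A C) (hA0 : A ≠ 0) (hA1 : A ≠ 1) (hn : n ≠ 0) :
    g ∈ iterativeRoots ψ n ↔
      ∃ a ∈ admissibleRoots A C n, HasNormalForm g a (C * (1 - a) / (1 - A)) := by
  have hAC := hψ.norm_add_norm_le_one
  have hE := one_add_mul_ne_zero hA1 hAC
  have hA1' : 1 - A ≠ 0 := sub_ne_zero.2 hA1.symm
  simp_rw [← div_mul_eq_mul_div C (1 - A)]
  constructor
  · rintro ⟨⟨G, hGd, hG⟩, hgn⟩
    have hcomm : Function.Commute g ψ := hgn ▸ Function.Commute.self_iterate g n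
    have hψ0 : ψ 0 = 0 := Complex.UnitDisc.coe_injective (by simp [(hψ 0).2])
    have hg0 : g 0 = 0 :=
      hψ.eq_zero_of_isFixedPt hA1 (by rw [← hcomm.eq, hψ0])
    have hG0 : G 0 = 0 := by simpa [hg0] using (hG 0).symm
    have hd : HasDerivAt G (deriv G 0) 0 :=
      (hGd.differentiableAt (Metric.ball_mem_nhds (0 : ℂ) one_pos)).hasDerivAt
    have hpow := pow_eq_of_iterate_eq hψ hG hg0 hd hgn
    have hform : HasNormalForm g (deriv G 0) (C / (1 - A) * (1 - deriv G 0)) := by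
      rcases lt_or_ge ‖A‖ 1 with hA | hA
      · rw [hasNormalForm_iff_koenigs hE]
        exact koenigs_apply_of_commute hψ hA0 hA hG hg0 hd hcomm
      · have hC : C = 0 := norm_eq_zero.1 (le_antisymm (by linarith) (norm_nonneg C))
        have hA' : ‖A‖ = 1 := le_antisymm (by linarith [norm_nonneg C]) hA
        have ha : ‖deriv G 0‖ = 1 := by
          rw [← hpow, norm_pow] at hA'
          exact (pow_eq_one_iff_of_nonneg (norm_nonneg _) hn).1 hA'
        have hmaps : Set.MapsTo G (Metric.ball 0 1) (Metric.closedBall (G 0) 1) := by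
          intro w hw
          have h := hG (.mk w (by simpa using hw))
          rw [Complex.UnitDisc.coe_mk] at h
          rw [← h, hG0]
          simpa using (Complex.UnitDisc.norm_lt_one _).le
        -- Equality in the Schwarz lemma: `g` is a rotation.
        have hlin := Complex.affine_of_mapsTo_ball_of_norm_dslope_eq_div hGd hmaps
          (Metric.mem_ball_self one_pos) (by rw [dslope_same, ha, div_one])
        intro z
        have h := hlin (show (z : ℂ) ∈ Metric.ball 0 1 by simpa using z.norm_lt_one)
        simp [hC, hG, h, hG0, mul_comm]
    refine ⟨deriv G 0, ⟨hpow, ?_⟩, hform⟩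
    have h := hform.norm_add_norm_le_one
    rw [div_mul_eq_mul_div, norm_div] at h
    rw [← div_le_iff₀ (norm_pos_iff.2 hA1')]
    linarith
  · rintro ⟨a, ⟨hpow, -⟩, hg⟩
    have ha : a ≠ 0 := by
      rintro rfl
      exact hA0 (by rw [← hpow, zero_pow hn])
    refine ⟨(hg.isLinearFractional ha).isAnalyticSelfMap, ?_⟩
    rw [hasNormalForm_iff_koenigs hE] at hg
    funext z
    refine Complex.UnitDisc.coe_injective (koenigs_injective (hE _) (hE _) ?_)
    rw [koenigs_iterate hg, hpow, hψ.koenigs_apply hA1]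

theorem ne_zero_of_mem_admissibleRoots {A C a : ℂ} {n : ℕ} (hA : A ≠ 0) (hn : n ≠ 0)
    (ha : a ∈ admissibleRoots A C n) : a ≠ 0 := by
  rintro rfl
  exact hA (by rw [← ha.1, zero_pow hn])

theorem exists_hasNormalForm_of_mem_admissibleRoots {A C a : ℂ} {n : ℕ} (hA1 : A ≠ 1)
    (ha : a ∈ admissibleRoots A C n) :
    ∃ g : 𝔻 → 𝔻, HasNormalForm g a (C * (1 - a) / (1 - A)) := by
  refine exists_hasNormalForm ?_
  have h := ha.2
  rw [← div_le_iff₀ (norm_pos_iff.2 (sub_ne_zero.2 hA1.symm)), ← norm_div] at h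
  linarith

theorem admissibleRoots_zero_encard {A : ℂ} {n : ℕ} (hA : ‖A‖ = 1) (hn : n ≠ 0) :
    (admissibleRoots A 0 n).encard = n := by
  classical
  have hA0 : A ≠ 0 := by
    rintro rfl
    simp at hA
  have hζ := Complex.isPrimitiveRoot_exp n hn
  have h : admissibleRoots A 0 n = ((Polynomial.nthRoots n A).toFinset : Set ℂ) := by
    ext a
    simp only [admissibleRoots, Set.mem_ofPred_eq, Finset.mem_coe, Multiset.mem_toFinset,
      Polynomial.mem_nthRoots (Nat.pos_of_ne_zero hn), and_iff_left_iff_imp]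
    intro ha
    rw [← ha, norm_pow] at hA
    simp [(pow_eq_one_iff_of_nonneg (norm_nonneg a) hn).1 hA]
  rw [h, Set.encard_coe_eq_coe_finsetCard,
    Multiset.toFinset_card_of_nodup (hζ.nthRoots_nodup hA0), hζ.card_nthRoots,
    if_pos (IsAlgClosed.exists_pow_nat_eq A (Nat.pos_of_ne_zero hn))]

theorem mainTheorem8 (φ : 𝔻 → 𝔻) (hlft : IsLinearFractional φ) (hell : IsElliptic φ)
    (p : 𝔻) (hp : φ p = p) :
    (∀ q : 𝔻, φ q = q → q = p) ∧
    ∃ A C : ℂ,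
      HasNormalForm (diskInvolution p ∘ φ ∘ diskInvolution p) A C ∧
      ‖A‖ + ‖C‖ ≤ 1 ∧ A ≠ 1 ∧
      ∀ n : ℕ, 1 ≤ n →
        (iterativeRoots φ n).encard = (admissibleRoots A C n).encard ∧
        (∃ F : ℂ → 𝔻 → 𝔻,
          Set.BijOn F (admissibleRoots A C n) (iterativeRoots φ n) ∧
          ∀ a ∈ admissibleRoots A C n, ∃ g : 𝔻 → 𝔻,
            HasNormalForm g a (C * (1 - a) / (1 - A)) ∧
            F a = diskInvolution p ∘ g ∘ diskInvolution p) ∧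
        (∀ f ∈ iterativeRoots φ n, IsLinearFractional f ∧ IsElliptic f) ∧
        (IsDiskAutomorphism φ → (iterativeRoots φ n).encard = n) := by
  have hι := diskInvolution_involutive p
  have hL := isLinearFractional_diskInvolution p
  set ψ := diskInvolution p ∘ φ ∘ diskInvolution p with hψdef
  have hψ0 : ψ 0 = 0 := by
    simp [ψ, diskInvolution_zero, hp, diskInvolution_self]
  obtain ⟨A, C, hA0, hψ⟩ := (hL.comp (hlft.comp hL)).exists_hasNormalForm hψ0
  have hAC := hψ.norm_add_norm_le_one
  have hA1 : A ≠ 1 := by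
    rintro rfl
    have hC : C = 0 := by
      rw [norm_one] at hAC
      exact norm_eq_zero.1 (le_antisymm (by linarith) (norm_nonneg C))
    have hid : ψ = id := funext fun z =>
      Complex.UnitDisc.coe_injective ((hψ z).2.trans (by simp [hC]))
    apply hell.2.1
    rw [← conj_conj_of_involutive hι φ, ← hψdef, hid]
    exact funext hι
  refine ⟨fun q hq => ?_, A, C, hψ, hAC, hA1, fun n hn => ?_⟩
  · have h : diskInvolution p q = 0 :=
      hψ.eq_zero_of_isFixedPt hA1 (by simp [hι q, hq])
    rw [← hι q, h, diskInvolution_zero]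
  replace hn : n ≠ 0 := Nat.one_le_iff_ne_zero.1 hn
  have hroot : ∀ f, f ∈ iterativeRoots φ n ↔ ∃ a ∈ admissibleRoots A C n,
      HasNormalForm (diskInvolution p ∘ f ∘ diskInvolution p) a (C * (1 - a) / (1 - A)) :=
    fun f => by rw [← conj_mem_iterativeRoots_iff p, hψ.mem_iterativeRoots_iff hA0 hA1 hn]
  choose! g hg using fun a (ha : a ∈ admissibleRoots A C n) =>
    exists_hasNormalForm_of_mem_admissibleRoots hA1 ha
  have hbij : Set.BijOn (fun a => diskInvolution p ∘ g a ∘ diskInvolution p)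
      (admissibleRoots A C n) (iterativeRoots φ n) := by
    refine ⟨fun a ha => ?_, fun a ha b hb hab => ?_, fun f hf => ?_⟩
    · rw [hroot, conj_conj_of_involutive hι]
      exact ⟨a, ha, hg a ha⟩
    · have hgab : g a = g b := by
        rw [← conj_conj_of_involutive hι (g a), ← conj_conj_of_involutive hι (g b)]
        exact congrArg (fun h => diskInvolution p ∘ h ∘ diskInvolution p) hab
      -- In the linearizing coordinate the two equal maps are multiplication by `a` and by `b`.
      have hE := one_add_mul_ne_zero hA1 hAC
      have hga := hg a ha
      have hgb := hg b hb
      rw [← div_mul_eq_mul_div, hasNormalForm_iff_koenigs hE] at hga hgb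
      have hz : ‖(1 / 2 : ℂ)‖ < 1 := by norm_num
      have h := hga (.mk _ hz)
      rw [hgab, hgb] at h
      exact (mul_right_cancel₀ (koenigs_ne_zero (hE _) (by simp)) h).symm
    · obtain ⟨a, ha, hfa⟩ := (hroot f).1 hf
      refine ⟨a, ha, ?_⟩
      change diskInvolution p ∘ g a ∘ diskInvolution p = f
      rw [(hg a ha).eq hfa, conj_conj_of_involutive hι]
  have hcard : (iterativeRoots φ n).encard = (admissibleRoots A C n).encard := by
    rw [← hbij.image_eq, hbij.injOn.encard_image]
  refine ⟨hcard, ⟨_, hbij, fun a ha => ⟨g a, hg a ha, rfl⟩⟩, fun f hf => ?_, fun haut => ?_⟩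
  · obtain ⟨a, ha, hfa⟩ := (hroot f).1 hf
    have hlf : IsLinearFractional f := by
      rw [← conj_conj_of_involutive hι f]
      exact hL.comp ((hfa.isLinearFractional (ne_zero_of_mem_admissibleRoots hA0 hn ha)).comp hL)
    refine ⟨hlf, hf.1, fun hid => hell.2.1 ?_, p, ?_⟩
    · rw [← hf.2, hid, Function.iterate_id]
    · have h0 : diskInvolution p (f p) = 0 :=
        Complex.UnitDisc.coe_injective (by simpa [diskInvolution_zero] using (hfa 0).2)
      rw [← hι (f p), h0, diskInvolution_zero]
  · obtain ⟨hA, rfl⟩ := hψ.norm_eq_one_of_surjective hA0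
      (hι.surjective.comp (haut.2.surjective.comp hι.surjective))
    rw [hcard, admissibleRoots_zero_encard hA hn]
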